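/- Let $X_1,X_2,\dots$ be i.i.d. integrable real random variables on a probability space $(\Omega,\mathcal F,\mathsf P)$ with $\mathsf E_{\mathsf P}[X_1]=0$ and finite variance $\sigma_{\mathsf P}^2:=\mathrm{Var}_{\mathsf P}[X_1]<\infty$. Put $S_k:=\sum_{i=1}^k X_i$, $\widehat\mu_k:=\frac1k\sum_{i=1}^k X_i$, $\widehat\sigma_k^2:=\frac1k\sum_{i=1}^k (X_i-\widehat\mu_k)^2$ with $\widehat\sigma_k\ge 0$, and $$\widehat{\mathsf U}^{(2)}_{\mathsf P}(x):=\mathsf E_{\mathsf P}\Big[\frac{X_1^2}{\sigma_{\mathsf P}^2}\,\mathbf 1\Big\{\frac{X_1^2}{\sigma_{\mathsf P}^2}\ge x\Big\}\Big],\qquad x\ge 0.$$ For $\varepsilon>0$ let $\zeta(z):=\sum_{j\ge1}j^{-z}$ ($z>1$) be the Riemann zeta function and $$c_\varepsilon:=\frac{(1+\varepsilon)^{5/4}+(1+\varepsilon)^{3/4}}{\sqrt2},\qquad \ell_\varepsilon:=\log\Big(\frac{2\zeta(1+\varepsilon)}{\log(1+\varepsilon)}\Big).$$ Then for every $\varepsilon>0$,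 every $\lambda\in(0,1/2)$ and every integer $m\ge 2$, $$\mathsf P\left[\sup_{k\ge m}\frac{|S_k/\widehat\sigma_k|}{c_\varepsilon\sqrt{(1+2\varepsilon)\,k\,\big(\log\log((1+\varepsilon)^2k)+\ell_\varepsilon\big)}}\ge 1\right]\le \frac{\big(\log_{1+\varepsilon}(2m/3)\big)^{-\varepsilon}}{\varepsilon\,\zeta(1+\varepsilon)}+\frac{786}{\min(\varepsilon^2,1)}\Big(m^{2\lambda-1}+\widehat{\mathsf U}^{(2)}_{\mathsf P}(m^\lambda)\Big).$$ Here the ratios are read with the conventions $0/0=0$ and $a/0=\infty$ for $a>0$. -/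

import Mathlib

open MeasureTheory ProbabilityTheory

namespace StudentizedLIL

/-- `P` is a probability measure under which the process `X` (whose members, listed from index `0`,
are the variables `X_1, X_2, …`) is an i.i.d. sequence of integrable, mean-zero random variables. -/
structure IsCenteredIID {Ω : Type*} [MeasurableSpace Ω] (X : ℕ → Ω → ℝ) (P : Measure Ω) :
    Prop where
  isProbabilityMeasure : IsProbabilityMeasure P
  indep : iIndepFun X P
  identDistrib : ∀ i, IdentDistrib (X i) (X 0) P P
  integrable : Integrable (X 0) P
  mean_zero : ∫ ω, X 0 ω ∂P = 0

/-- The partial sum `S_k = X_1 + ⋯ + X_k`, i.e. the sum of the first `k` variables. -/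
def partialSum {Ω : Type*} (X : ℕ → Ω → ℝ) (k : ℕ) (ω : Ω) : ℝ :=
  ∑ i ∈ Finset.range k, X i ω

/-- The sample mean of the first `n` variables. -/
noncomputable def sampleMean {Ω : Type*} (X : ℕ → Ω → ℝ) (n : ℕ) (ω : Ω) : ℝ :=
  (1 / (n : ℝ)) * ∑ i ∈ Finset.range n, X i ω

/-- The sample variance of the first `n` variables (normalized by `n`). -/
noncomputable def sampleVariance {Ω : Type*} (X : ℕ → Ω → ℝ) (n : ℕ) (ω : Ω) : ℝ :=
  (1 / (n : ℝ)) * ∑ i ∈ Finset.range n, (X i ω - sampleMean X n ω) ^ 2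

/-- The sample standard deviation of the first `n` variables. -/
noncomputable def sampleStd {Ω : Type*} (X : ℕ → Ω → ℝ) (n : ℕ) (ω : Ω) : ℝ :=
  Real.sqrt (sampleVariance X n ω)

/-- The truncated normalized second moment
`E_P[(X_1² / σ_P²) 1{X_1² / σ_P² ≥ x}]`, where `σ_P²` is the variance of `X_1` under `P`. -/
noncomputable def truncatedNormalizedSecondMoment {Ω : Type*} [MeasurableSpace Ω]
    (X : ℕ → Ω → ℝ) (P : Measure Ω) (x : ℝ) : ℝ :=
  ∫ ω, Set.indicator {ω | x ≤ X 0 ω ^ 2 / variance (X 0) P}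
    (fun ω => X 0 ω ^ 2 / variance (X 0) P) ω ∂P

/-- The Riemann zeta function at real arguments `z > 1`, as the series `∑_{j ≥ 1} j^{-z}`. -/
noncomputable def zeta (z : ℝ) : ℝ := ∑' j : ℕ, 1 / ((j : ℝ) + 1) ^ z

/-- The series agrees with Mathlib's Riemann zeta function for `z > 1`. -/
theorem zeta_eq_riemannZeta {z : ℝ} (hz : 1 < z) : (zeta z : ℂ) = riemannZeta (z : ℂ) := by
  rw [zeta_eq_tsum_one_div_nat_add_one_cpow (by simpa using hz), zeta, Complex.ofReal_tsum]
  refine tsum_congr fun j => ?_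
  have hj : (0 : ℝ) ≤ (j : ℝ) + 1 := by positivity
  push_cast [Complex.ofReal_cpow hj]
  rfl

/-- The constant `c_ε = ((1+ε)^{5/4} + (1+ε)^{3/4}) / √2`. -/
noncomputable def cConst (ε : ℝ) : ℝ :=
  ((1 + ε) ^ (5 / 4 : ℝ) + (1 + ε) ^ (3 / 4 : ℝ)) / Real.sqrt 2

/-- The constant `ℓ_ε = log (2 ζ(1+ε) / log (1+ε))`. -/
noncomputable def ellConst (ε : ℝ) : ℝ :=
  Real.log (2 * zeta (1 + ε) / Real.log (1 + ε))

/-- The boundary `c_ε √((1+2ε) k (log log ((1+ε)² k) + ℓ_ε))`. -/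
noncomputable def boundary (ε : ℝ) (k : ℕ) : ℝ :=
  cConst ε * Real.sqrt ((1 + 2 * ε) * k *
    (Real.log (Real.log ((1 + ε) ^ 2 * k)) + ellConst ε))

/-- The studentized ratio `|S_k / σ̂_k| / boundary`, with values in `[0, ∞]`, so that it is `∞` where
`σ̂_k = 0 ≠ S_k` and `0` where `σ̂_k = 0 = S_k`. -/
noncomputable def studentizedRatio {Ω : Type*} (X : ℕ → Ω → ℝ) (ε : ℝ) (k : ℕ) (ω : Ω) : ENNReal :=
  ENNReal.ofReal |partialSum X k ω| / ENNReal.ofReal (sampleStd X k ω) /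
    ENNReal.ofReal (boundary ε k)

end StudentizedLIL

/-! After scaling to unit variance, let V_k be the sum of the first k squares and w_k = V_k/3 +
2k/3. The inequality exp(x - x²/6) ≤ 1 + x + x²/3 makes exp(θ S_k - θ² w_k/2) at most a product of
independent factors of mean ≤ 1 in expectation, so Ville's inequality bounds by exp(-b) the chance
that this exponent ever reaches b (`measureReal_exists_line_crossing_le`). Each θ thus gives a line
in w that S rarely crosses. Stitching one line per geometric epoch of w, with summable error
probabilities, produces an iterated-logarithm curve in w and the first term of the bound
(`measureReal_exists_stitchedBoundary_le`).

The curve must then be moved from w_k to k σ̂_k². This works whenever V_k/k is near 1 and S_k/k near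
0 (`stitchedBoundary_le_boundary_mul_sampleStd`), which is needed for all k ≥ m at once. With only
two moments, the squares are split at m^λ: the small ones have variance at most m^λ and obey a
maximal Chebyshev bound; the large ones are merely integrable, and the weak-type maximal ergodic
bound controls their averages at the cost of their mean, the truncated moment. These failures make
up the second term (`measureReal_exists_moments_far_le`).

The constant c_ε leaves a spare factor √(1+ε), which turns a supremum of at least 1, possibly not
attained, into a genuine crossing at some k. -/

namespace StudentizedLIL

/-! ### Maximal inequalities of Ville, Kolmogorov and Chebyshev type. -/

section MaximalInequalities

variable {Ω : Type*} [MeasurableSpace Ω] {P : Measure Ω}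

/-- Continuity from below along an increasing union; no measurability of the events is needed. -/
lemma measureReal_exists_le_of_forall_le [IsFiniteMeasure P] {p : ℕ → Ω → Prop} {b : ℝ}
    (h : ∀ n, P.real {ω | ∃ k ≤ n, p k ω} ≤ b) : P.real {ω | ∃ k, p k ω} ≤ b := by
  have hU : {ω | ∃ k, p k ω} = ⋃ n, {ω | ∃ k ≤ n, p k ω} := by
    ext ω
    simp only [Set.mem_ofPred_eq, Set.mem_iUnion]
    exact ⟨fun ⟨k, hk⟩ => ⟨k, k, le_rfl, hk⟩, fun ⟨_, k, _, hk⟩ => ⟨k, hk⟩⟩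
  have hmono : Monotone fun n => {ω | ∃ k ≤ n, p k ω} :=
    fun a b hab ω ⟨k, hk, hp⟩ => ⟨k, hk.trans hab, hp⟩
  have ht := tendsto_measure_iUnion_atTop (μ := P) hmono
  rw [← hU] at ht
  exact le_of_tendsto ((ENNReal.tendsto_toReal (measure_ne_top _ _)).comp ht)
    (Filter.Eventually.of_forall h)

lemma measureReal_exists_le_of_sum_le [IsFiniteMeasure P] {p : ℕ → Ω → Prop} {b : ℕ → ℝ} {B : ℝ}
    (h : ∀ j, P.real {ω | p j ω} ≤ b j) (hB : ∀ n, ∑ j ∈ Finset.range n, b j ≤ B) :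
    P.real {ω | ∃ k, p k ω} ≤ B := by
  refine measureReal_exists_le_of_forall_le fun n => ?_
  have hU : {ω | ∃ k ≤ n, p k ω} = ⋃ k ∈ Finset.range (n + 1), {ω | p k ω} := by
    ext ω
    simp
  rw [hU]
  exact (measureReal_biUnion_finset_le _ _).trans
    ((Finset.sum_le_sum fun j _ => h j).trans (hB _))

lemma Submartingale.measureReal_exists_ge_le [IsFiniteMeasure P]
    {𝒢 : Filtration ℕ ‹MeasurableSpace Ω›} {f : ℕ → Ω → ℝ} (hsub : Submartingale f 𝒢 P)
    (hnonneg : 0 ≤ f) {c : ℝ} (hc : 0 < c) (n : ℕ) :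
    P.real {ω | ∃ k ≤ n, c ≤ f k ω} ≤ (∫ ω, f n ω ∂P) / c := by
  have h := maximal_ineq hsub hnonneg (ε := c.toNNReal) n
  have hs : {ω | ((c.toNNReal : NNReal) : ℝ) ≤ (Finset.range (n + 1)).sup'
      Finset.nonempty_range_add_one fun k => f k ω} = {ω | ∃ k ≤ n, c ≤ f k ω} := by
    ext ω
    simp [Finset.le_sup'_iff, Real.coe_toNNReal _ hc.le]
  rw [hs] at h
  rw [le_div_iff₀ hc]
  have hint : ∫ ω in {ω | ∃ k ≤ n, c ≤ f k ω}, f n ω ∂P ≤ ∫ ω, f n ω ∂P :=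
    setIntegral_le_integral (hsub.integrable n) (Filter.Eventually.of_forall (hnonneg n))
  have h2 := ENNReal.toReal_mono ENNReal.ofReal_ne_top (h.trans (ENNReal.ofReal_le_ofReal hint))
  rw [ENNReal.toReal_mul, ENNReal.toReal_ofReal (integral_nonneg (hnonneg n))] at h2
  simpa [Real.coe_toNNReal _ hc.le, Measure.real, mul_comm] using h2

lemma iIndepFun.integrable_prod_range {R : ℕ → Ω → ℝ} (hind : iIndepFun R P)
    (hmeas : ∀ i, Measurable (R i)) (hint : ∀ i, Integrable (R i) P) (n : ℕ) :
    Integrable (fun ω => ∏ i ∈ Finset.range n, R i ω) P := by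
  have := hind.isProbabilityMeasure
  induction n with
  | zero => simp
  | succ n ih =>
    have hi := hind.indepFun_prod_range_succ hmeas n
    have h2 := hi.integrable_mul (by convert ih using 1; ext; simp) (hint n)
    convert h2 using 1
    ext ω
    simp [Finset.prod_range_succ]

lemma adapted_range_succ {X : ℕ → Ω → ℝ} (hX : ∀ i, StronglyMeasurable (X i)) (n : ℕ) {i : ℕ}
    (hi : i ∈ Finset.range (n + 1)) : StronglyMeasurable[Filtration.natural X hX n] (X i) :=
  (Filtration.stronglyAdapted_natural hX i).mono
    ((Filtration.natural X hX).mono (Nat.lt_succ_iff.1 (Finset.mem_range.1 hi)))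

lemma iIndepFun.martingale_prod {R : ℕ → Ω → ℝ} (hind : iIndepFun R P)
    (hmeas : ∀ i, Measurable (R i)) (hint : ∀ i, Integrable (R i) P) (hone : ∀ i, ∫ ω, R i ω ∂P = 1) :
    Martingale (fun n ω => ∏ i ∈ Finset.range (n + 1), R i ω)
      (Filtration.natural R fun i => (hmeas i).stronglyMeasurable) P := by
  have := hind.isProbabilityMeasure
  have hadp : StronglyAdapted (Filtration.natural R fun i => (hmeas i).stronglyMeasurable)
      (fun n ω => ∏ i ∈ Finset.range (n + 1), R i ω) := fun n =>
    Finset.stronglyMeasurable_fun_prod _ fun i hi => adapted_range_succ _ n hi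
  have hI := fun n => iIndepFun.integrable_prod_range hind hmeas hint (n + 1)
  refine martingale_nat hadp hI fun n => ?_
  have hmul : (fun ω => ∏ i ∈ Finset.range (n + 1 + 1), R i ω) =
      (fun ω => ∏ i ∈ Finset.range (n + 1), R i ω) * R (n + 1) := by
    ext ω
    simp [Finset.prod_range_succ]
  have h1 := condExp_mul_of_stronglyMeasurable_left (μ := P) (hadp n)
    (by rw [← hmul]; exact hI (n + 1)) (hint (n + 1))
  have h2 := hind.condExp_natural_ae_eq_of_lt (fun i => (hmeas i).stronglyMeasurable)
    (Nat.lt_succ_self n)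
  rw [hmul]
  filter_upwards [h1, h2] with ω h1 h2
  rw [h1, Pi.mul_apply, h2, hone, mul_one]

/-- **Ville's inequality** for products of independent nonnegative variables of equal mean `q ≤ 1`. -/
lemma iIndepFun.measureReal_exists_prod_ge_le {R : ℕ → Ω → ℝ} (hind : iIndepFun R P)
    (hmeas : ∀ i, Measurable (R i)) (hint : ∀ i, Integrable (R i) P) (hnonneg : ∀ i ω, 0 ≤ R i ω)
    {q : ℝ} (hq0 : 0 < q) (hq1 : q ≤ 1) (hq : ∀ i, ∫ ω, R i ω ∂P = q) {c : ℝ} (hc : 0 < c) :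
    P.real {ω | ∃ k, c ≤ ∏ i ∈ Finset.range (k + 1), R i ω} ≤ 1 / c := by
  have := hind.isProbabilityMeasure
  set T : ℕ → Ω → ℝ := fun i ω => R i ω / q with hT
  have hTm : ∀ i, Measurable (T i) := fun i => (hmeas i).div_const q
  have hTind : iIndepFun T P := hind.comp (fun _ x => x / q) fun _ => measurable_id.div_const q
  have hT1 : ∀ i, ∫ ω, T i ω ∂P = 1 := fun i => by
    rw [hT, integral_div, hq, div_self hq0.ne']
  have hM := iIndepFun.martingale_prod hTind hTm (fun i => (hint i).div_const q) hT1
  refine measureReal_exists_le_of_forall_le fun n => ?_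
  have h0 := Submartingale.measureReal_exists_ge_le hM.submartingale
    (fun k ω => Finset.prod_nonneg fun i _ => div_nonneg (hnonneg i ω) hq0.le) hc n
  have hE : ∫ ω, ∏ i ∈ Finset.range (n + 1), T i ω ∂P = 1 := by
    have := hM.setIntegral_eq (Nat.zero_le n) MeasurableSet.univ
    simp only [setIntegral_univ] at this
    rw [← this]
    simpa using hT1 0
  rw [hE] at h0
  refine le_trans (measureReal_mono ?_) h0
  rintro ω ⟨k, hk, hck⟩
  refine ⟨k, hk, hck.trans (Finset.prod_le_prod (fun i _ => hnonneg i ω) fun i _ => ?_)⟩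
  rw [hT]
  exact le_div_self (hnonneg i ω) hq0 hq1

/-- The increment of the squared sum is at least 2 S_n Y_{n+1}, whose conditional expectation given
the past vanishes. -/
lemma iIndepFun.submartingale_sq_sum {Y : ℕ → Ω → ℝ} (hind : iIndepFun Y P)
    (hmeas : ∀ i, Measurable (Y i)) (hL2 : ∀ i, MemLp (Y i) 2 P) (hzero : ∀ i, ∫ ω, Y i ω ∂P = 0) :
    Submartingale (fun n ω => (∑ i ∈ Finset.range (n + 1), Y i ω) ^ 2)
      (Filtration.natural Y fun i => (hmeas i).stronglyMeasurable) P := by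
  have := hind.isProbabilityMeasure
  have hadp : ∀ n, StronglyMeasurable[Filtration.natural Y (fun i => (hmeas i).stronglyMeasurable) n]
      (fun ω => ∑ i ∈ Finset.range (n + 1), Y i ω) := fun n =>
    Finset.stronglyMeasurable_fun_sum _ fun i hi => adapted_range_succ _ n hi
  have hS : ∀ n, MemLp (fun ω => ∑ i ∈ Finset.range (n + 1), Y i ω) 2 P := fun n =>
    memLp_finsetSum _ fun i _ => hL2 i
  refine submartingale_of_condExp_sub_nonneg_nat (fun n => (hadp n).pow 2)
    (fun n => (hS n).integrable_sq) fun n => ?_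
  set S : Ω → ℝ := fun ω => ∑ i ∈ Finset.range (n + 1), Y i ω
  have hSY : Integrable ((fun ω => 2 * S ω) * Y (n + 1)) P :=
    ((hS n).const_mul 2).integrable_mul (hL2 (n + 1))
  have h1 := condExp_mul_of_stronglyMeasurable_left (μ := P) ((hadp n).const_mul 2) hSY
    ((hL2 (n + 1)).integrable one_le_two)
  have h2 := hind.condExp_natural_ae_eq_of_lt (fun i => (hmeas i).stronglyMeasurable)
    (Nat.lt_succ_self n)
  have h3 := condExp_mono (m := Filtration.natural Y (fun i => (hmeas i).stronglyMeasurable) n)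
    hSY ((hS (n + 1)).integrable_sq.sub (hS n).integrable_sq)
    (Filter.Eventually.of_forall fun ω => by
      simp only [Pi.mul_apply, Pi.sub_apply, Finset.sum_range_succ _ (n + 1)]
      change 2 * S ω * Y (n + 1) ω ≤ (S ω + Y (n + 1) ω) ^ 2 - S ω ^ 2
      nlinarith [sq_nonneg (Y (n + 1) ω)])
  filter_upwards [h1, h2, h3] with ω h1 h2 h3
  rw [h1, Pi.mul_apply, h2, hzero, mul_zero] at h3
  exact h3

/-- **Kolmogorov's maximal inequality**. -/
lemma iIndepFun.measureReal_exists_abs_sum_ge_le {Y : ℕ → Ω → ℝ} (hind : iIndepFun Y P)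
    (hmeas : ∀ i, Measurable (Y i)) (hL2 : ∀ i, MemLp (Y i) 2 P) (hzero : ∀ i, ∫ ω, Y i ω ∂P = 0)
    {s : ℝ} (hs : ∀ i, ∫ ω, Y i ω ^ 2 ∂P ≤ s) {c : ℝ} (hc : 0 < c) (n : ℕ) :
    P.real {ω | ∃ k ≤ n, c ≤ |∑ i ∈ Finset.range k, Y i ω|} ≤ n * s / c ^ 2 := by
  have := hind.isProbabilityMeasure
  cases n with
  | zero => simp [not_le.2 hc]
  | succ n =>
    have h0 := Submartingale.measureReal_exists_ge_le
      (iIndepFun.submartingale_sq_sum hind hmeas hL2 hzero) (fun k ω => sq_nonneg _)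
      (pow_pos hc 2) n
    have hvar : ∫ ω, (∑ i ∈ Finset.range (n + 1), Y i ω) ^ 2 ∂P ≤ (n + 1 : ℕ) * s := by
      have hv := IndepFun.variance_sum (s := Finset.range (n + 1)) (X := Y) (fun i _ => hL2 i)
        fun i _ j _ hij => hind.indepFun hij
      have hm : ∫ ω, (∑ i ∈ Finset.range (n + 1), Y i) ω ∂P = 0 := by
        simp only [Finset.sum_apply]
        rw [integral_finsetSum _ fun i _ => (hL2 i).integrable one_le_two]
        simp [hzero]
      rw [variance_of_integral_eq_zero (by fun_prop) hm] at hv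
      simp only [Finset.sum_apply] at hv
      rw [hv]
      calc ∑ i ∈ Finset.range (n + 1), variance (Y i) P ≤ ∑ _i ∈ Finset.range (n + 1), s :=
            Finset.sum_le_sum fun i _ => by
              rw [variance_of_integral_eq_zero (hmeas i).aemeasurable (hzero i)]
              exact hs i
        _ = _ := by simp
    refine (measureReal_mono ?_).trans (h0.trans (div_le_div_of_nonneg_right hvar (by positivity)))
    rintro ω ⟨k, hk, hck⟩
    cases k with
    | zero => simp at hck; linarith
    | succ k => exact ⟨k, by omega, by rw [← sq_abs (∑ i ∈ _, _)]; gcongr⟩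

/-- A maximal form of Chebyshev's inequality for the averages of at least `m` variables. -/
lemma iIndepFun.measureReal_exists_ge_abs_sum_ge_le {Y : ℕ → Ω → ℝ} (hind : iIndepFun Y P)
    (hmeas : ∀ i, Measurable (Y i)) (hL2 : ∀ i, MemLp (Y i) 2 P) (hzero : ∀ i, ∫ ω, Y i ω ∂P = 0)
    {s : ℝ} (hs : ∀ i, ∫ ω, Y i ω ^ 2 ∂P ≤ s) {δ : ℝ} (hδ : 0 < δ) {m : ℕ} (hm : 0 < m) :
    P.real {ω | ∃ k ≥ m, δ * k ≤ |∑ i ∈ Finset.range k, Y i ω|} ≤ 4 * s / (δ ^ 2 * m) := by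
  have := hind.isProbabilityMeasure
  have hm' : (0 : ℝ) < m := by exact_mod_cast hm
  have hs0 : 0 ≤ s := (integral_nonneg fun ω => sq_nonneg _).trans (hs 0)
  -- Dyadic blocks 2^j m ≤ k < 2^(j+1) m: Kolmogorov's inequality costs 2s/(δ²m) · 2^(-j) on block
  -- j, and the geometric series sums to the factor 4.
  refine (measureReal_mono (s₂ := {ω | ∃ j : ℕ, ∃ k ≤ 2 ^ (j + 1) * m,
    δ * (2 ^ j * m) ≤ |∑ i ∈ Finset.range k, Y i ω|}) ?_).trans
    (measureReal_exists_le_of_sum_le (b := fun j => 2 * s / (δ ^ 2 * m) * (1 / 2) ^ j)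
      (fun j => ?_) fun n => ?_)
  · rintro ω ⟨k, hk, hck⟩
    have hkm : (1 : ℝ) ≤ k / m := by
      rw [one_le_div hm']; exact_mod_cast hk
    obtain ⟨j, h1, h2⟩ := exists_nat_pow_near hkm one_lt_two
    rw [le_div_iff₀ hm'] at h1
    rw [div_lt_iff₀ hm'] at h2
    exact ⟨j, k, by exact_mod_cast h2.le, (by gcongr : _ ≤ δ * k).trans hck⟩
  · refine (iIndepFun.measureReal_exists_abs_sum_ge_le hind hmeas hL2 hzero hs
      (by positivity) _).trans (le_of_eq ?_)
    push_cast
    rw [one_div, inv_pow]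
    field_simp
    ring
  · rw [← Finset.mul_sum]
    have hg : ∑ j ∈ Finset.range n, (1 / 2 : ℝ) ^ j ≤ 2 := by
      rw [geom_sum_eq (by norm_num), div_le_iff_of_neg (by norm_num)]
      have : (0 : ℝ) ≤ (1 / 2) ^ n := by positivity
      linarith
    calc _ ≤ 2 * s / (δ ^ 2 * m) * 2 := by gcongr
      _ = _ := by ring

end MaximalInequalities

/-! ### The maximal ergodic inequality by Garsia's argument. -/

section MaximalErgodic

/-- The maximum of the partial sums of order at most `n` of a real sequence. -/
noncomputable def maxPartialSum : ℕ → (ℕ → ℝ) → ℝ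
  | 0, _ => 0
  | n + 1, x => max 0 (x 0 + maxPartialSum n fun i => x (i + 1))

lemma maxPartialSum_nonneg (n : ℕ) (x : ℕ → ℝ) : 0 ≤ maxPartialSum n x := by
  cases n with
  | zero => exact le_rfl
  | succ n => exact le_max_left _ _

lemma maxPartialSum_le_succ (n : ℕ) (x : ℕ → ℝ) : maxPartialSum n x ≤ maxPartialSum (n + 1) x := by
  induction n generalizing x with
  | zero => exact le_max_left _ _
  | succ n ih => exact max_le_max le_rfl (add_le_add le_rfl (ih _))

lemma sum_range_le_maxPartialSum {n k : ℕ} (hk : k ≤ n) (x : ℕ → ℝ) :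
    ∑ i ∈ Finset.range k, x i ≤ maxPartialSum n x := by
  induction n generalizing x k with
  | zero => simp [Nat.le_zero.1 hk, maxPartialSum]
  | succ n ih =>
    cases k with
    | zero => simpa using maxPartialSum_nonneg _ _
    | succ k =>
      rw [Finset.sum_range_succ', add_comm]
      exact (add_le_add le_rfl (ih (Nat.le_of_succ_le_succ hk) _)).trans (le_max_right _ _)

lemma measurable_maxPartialSum (n : ℕ) : Measurable (maxPartialSum n) := by
  induction n with
  | zero => exact measurable_const
  | succ n ih =>
    exact measurable_const.max ((measurable_pi_apply 0).add
      (ih.comp (measurable_pi_lambda _ fun i => measurable_pi_apply (i + 1))))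

variable {Ω : Type*} [MeasurableSpace Ω] {P : Measure Ω}

lemma integrable_maxPartialSum [IsFiniteMeasure P] (n : ℕ) {Y : ℕ → Ω → ℝ}
    (hint : ∀ i, Integrable (Y i) P) : Integrable (fun ω => maxPartialSum n fun i => Y i ω) P := by
  induction n generalizing Y with
  | zero => exact integrable_const 0
  | succ n ih =>
    exact (integrable_const (0 : ℝ)).sup ((hint 0).add (ih fun i => hint (i + 1)))

/-- The joint law of an i.i.d. sequence is shift-invariant, so the shift serves as the
measure-preserving map. -/
lemma integral_maxPartialSum_shift {Y : ℕ → Ω → ℝ} (hind : iIndepFun Y P)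
    (hid : ∀ i, IdentDistrib (Y i) (Y 0) P P) (n : ℕ) :
    ∫ ω, maxPartialSum n (fun i => Y (i + 1) ω) ∂P = ∫ ω, maxPartialSum n (fun i => Y i ω) ∂P := by
  have h : IdentDistrib (fun ω i => Y (i + 1) ω) (fun ω i => Y i ω) P P :=
    IdentDistrib.pi (fun i => (hid (i + 1)).trans (hid i).symm)
      (hind.precomp (add_left_injective 1)) hind
  exact (h.comp (measurable_maxPartialSum n)).integral_eq

/-- The **maximal ergodic inequality** for an i.i.d. sequence. -/
lemma setIntegral_maxPartialSum_pos_nonneg {Y : ℕ → Ω → ℝ} (hmeas : ∀ i, Measurable (Y i))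
    (hind : iIndepFun Y P) (hid : ∀ i, IdentDistrib (Y i) (Y 0) P P)
    (hint : Integrable (Y 0) P) (n : ℕ) :
    0 ≤ ∫ ω in {ω | 0 < maxPartialSum (n + 1) fun i => Y i ω}, Y 0 ω ∂P := by
  have := hind.isProbabilityMeasure
  have hI : ∀ i, Integrable (Y i) P := fun i => (hid i).symm.integrable_snd hint
  set A := {ω | 0 < maxPartialSum (n + 1) fun i => Y i ω} with hA
  have hAm : MeasurableSet A := measurableSet_lt measurable_const
    ((measurable_maxPartialSum _).comp (measurable_pi_lambda _ hmeas))
  have hint' := integrable_maxPartialSum n fun i => hI (i + 1)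
  -- Where the maximum is positive, the recursion gives M_{n+1} = Y_0 + M_n ∘ shift. Integrating,
  -- with M_n ≤ M_{n+1} and shift invariance, leaves a nonnegative integral of Y_0.
  have h1 : ∫ ω, maxPartialSum (n + 1) (fun i => Y i ω) ∂P =
      ∫ ω in A, (Y 0 ω + maxPartialSum n fun i => Y (i + 1) ω) ∂P := by
    rw [← integral_indicator hAm]
    refine integral_congr_ae (Filter.Eventually.of_forall fun ω => ?_)
    by_cases h : ω ∈ A
    · simp only [Set.indicator_of_mem h]
      rw [hA, Set.mem_ofPred_eq, maxPartialSum, lt_max_iff] at h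
      exact max_eq_right (h.resolve_left (lt_irrefl _)).le
    · simp only [Set.indicator_of_notMem h]
      exact le_antisymm (not_lt.1 h) (maxPartialSum_nonneg _ _)
  rw [integral_add hint.integrableOn hint'.integrableOn] at h1
  have h2 : ∫ ω in A, maxPartialSum n (fun i => Y (i + 1) ω) ∂P ≤
      ∫ ω, maxPartialSum n (fun i => Y (i + 1) ω) ∂P :=
    setIntegral_le_integral hint' (Filter.Eventually.of_forall fun ω => maxPartialSum_nonneg _ _)
  have h3 : ∫ ω, maxPartialSum n (fun i => Y i ω) ∂P ≤
      ∫ ω, maxPartialSum (n + 1) (fun i => Y i ω) ∂P :=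
    integral_mono (integrable_maxPartialSum n hI) (integrable_maxPartialSum (n + 1) hI)
      fun ω => maxPartialSum_le_succ _ _
  rw [integral_maxPartialSum_shift hind hid] at h2
  linarith

/-- The weak-type bound for the maximal average of an i.i.d. sequence of nonnegative variables. -/
lemma measureReal_exists_sum_gt_le {Z : ℕ → Ω → ℝ} (hmeas : ∀ i, Measurable (Z i))
    (hind : iIndepFun Z P) (hid : ∀ i, IdentDistrib (Z i) (Z 0) P P) (hint : Integrable (Z 0) P)
    (hnonneg : ∀ ω, 0 ≤ Z 0 ω) {δ : ℝ} (hδ : 0 < δ) :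
    P.real {ω | ∃ k : ℕ, δ * k < ∑ i ∈ Finset.range k, Z i ω} ≤ (∫ ω, Z 0 ω ∂P) / δ := by
  have := hind.isProbabilityMeasure
  refine measureReal_exists_le_of_forall_le fun n => ?_
  -- An average of Z above δ is a positive partial sum of Z - δ, so the maximal inequality reads δ
  -- P(A) ≤ ∫_A Z_0.
  set Y : ℕ → Ω → ℝ := fun i ω => Z i ω - δ
  have hYm : ∀ i, Measurable (Y i) := fun i => (hmeas i).sub_const δ
  have h := setIntegral_maxPartialSum_pos_nonneg (Y := Y) hYm
    (hind.comp (fun _ x => x - δ) fun _ => measurable_id.sub_const δ)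
    (fun i => (hid i).sub_const δ) (hint.sub (integrable_const δ)) n
  set A := {ω | 0 < maxPartialSum (n + 1) fun i => Y i ω}
  have hsplit : ∫ ω in A, Y 0 ω ∂P = ∫ ω in A, Z 0 ω ∂P - P.real A * δ := by
    rw [integral_sub hint.integrableOn (integrable_const δ)]
    simp
  have hle : ∫ ω in A, Z 0 ω ∂P ≤ ∫ ω, Z 0 ω ∂P :=
    setIntegral_le_integral hint (Filter.Eventually.of_forall hnonneg)
  rw [le_div_iff₀ hδ]
  have hsub : P.real {ω | ∃ k ≤ n, δ * k < ∑ i ∈ Finset.range k, Z i ω} ≤ P.real A := by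
    refine measureReal_mono ?_
    rintro ω ⟨k, hk, hck⟩
    refine lt_of_lt_of_le ?_ (sum_range_le_maxPartialSum (hk.trans n.le_succ) _)
    simp only [Y, Finset.sum_sub_distrib, Finset.sum_const, Finset.card_range, nsmul_eq_mul]
    linarith
  nlinarith

end MaximalErgodic

/-! ### Self-normalized exponential martingales and line crossing. -/

section ExponentialBound

/-- The difference g of logarithms satisfies g(0) = 0 and has derivative y³/9 over a positive
quadratic, so its minimum is at 0. The bound needs no sign or size restriction on x. -/
lemma exp_sub_sq_div_six_le (x : ℝ) : Real.exp (x - x ^ 2 / 6) ≤ 1 + x + x ^ 2 / 3 := by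
  have hpos : ∀ y : ℝ, 0 < 1 + y + y ^ 2 / 3 := fun y => by nlinarith [sq_nonneg (y + 3 / 2)]
  set g : ℝ → ℝ := fun y => Real.log (1 + y + y ^ 2 / 3) - y + y ^ 2 / 6 with hg
  have hd : ∀ y, HasDerivAt g (y ^ 3 / 9 / (1 + y + y ^ 2 / 3)) y := fun y => by
    have h1 : HasDerivAt (fun y : ℝ => 1 + y + y ^ 2 / 3) (1 + 2 * y / 3) y := by
      exact (((hasDerivAt_id' y).const_add 1).add (((hasDerivAt_id' y).pow 2).div_const 3)).congr_deriv
        (by simp)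
    have h2 : HasDerivAt (fun y : ℝ => y ^ 2 / 6) (2 * y / 6) y := by
      simpa using ((hasDerivAt_id y).pow 2).div_const 6
    have h3 := ((h1.log (hpos y).ne').sub (hasDerivAt_id y)).add h2
    refine h3.congr_deriv ?_
    have := (hpos y).ne'
    rw [eq_div_iff this, add_mul, sub_mul, div_mul_cancel₀ _ this]
    ring
  have hcont : Continuous g := continuous_iff_continuousAt.2 fun y => (hd y).continuousAt
  have hnn : 0 ≤ g x := by
    have h0 : g 0 = 0 := by simp [hg]
    rcases le_total 0 x with hx | hx
    · have hm : MonotoneOn g (Set.Ici 0) := monotoneOn_of_deriv_nonneg (convex_Ici 0)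
        hcont.continuousOn (fun y _ => (hd y).differentiableAt.differentiableWithinAt) fun y hy => by
          rw [interior_Ici] at hy
          rw [(hd y).deriv]
          have : 0 < y := hy
          have := hpos y
          positivity
      rw [← h0]
      exact hm Set.self_mem_Ici hx hx
    · have hm : AntitoneOn g (Set.Iic 0) := antitoneOn_of_deriv_nonpos (convex_Iic 0)
        hcont.continuousOn (fun y _ => (hd y).differentiableAt.differentiableWithinAt) fun y hy => by
          rw [interior_Iic] at hy
          rw [(hd y).deriv]
          have hy' : y < 0 := hy
          have h3 : y ^ 3 ≤ 0 := (Odd.pow_neg (by decide) hy').le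
          exact div_nonpos_of_nonpos_of_nonneg (by linarith) (hpos y).le
      rw [← h0]
      exact hm hx Set.self_mem_Iic hx
  rw [← Real.le_log_iff_exp_le (hpos x)]
  simp only [hg] at hnn
  linarith

/-- The intrinsic time `V_k / 3 + 2 k / 3`, where `V_k` is the sum of the first `k` squares. -/
noncomputable def intrinsicTime {Ω : Type*} (X : ℕ → Ω → ℝ) (k : ℕ) (ω : Ω) : ℝ :=
  (∑ i ∈ Finset.range k, X i ω ^ 2) / 3 + 2 * k / 3

lemma two_thirds_mul_le_intrinsicTime (k : ℕ) (ω : Ω) : 2 * k / 3 ≤ intrinsicTime X k ω := by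
  have : 0 ≤ ∑ i ∈ Finset.range k, X i ω ^ 2 := Finset.sum_nonneg fun i _ => sq_nonneg _
  rw [intrinsicTime]
  linarith

variable {Ω : Type*} [MeasurableSpace Ω] {P : Measure Ω} {X : ℕ → Ω → ℝ}

/-- The self-normalized line-crossing inequality for centered i.i.d. variables of unit variance. -/
lemma measureReal_exists_line_crossing_le (hX : ∀ i, Measurable (X i)) (hind : iIndepFun X P)
    (hid : ∀ i, IdentDistrib (X i) (X 0) P P) (hL2 : MemLp (X 0) 2 P) (hzero : ∫ ω, X 0 ω ∂P = 0)
    (hone : ∫ ω, X 0 ω ^ 2 ∂P = 1) (θ b : ℝ) :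
    P.real {ω | ∃ k ≥ 1, b ≤ θ * partialSum X k ω - θ ^ 2 / 2 * intrinsicTime X k ω} ≤
      Real.exp (-b) := by
  have := hind.isProbabilityMeasure
  set f : ℝ → ℝ := fun x => Real.exp (θ * x - (θ * x) ^ 2 / 6) * Real.exp (-(θ ^ 2 / 3)) with hf
  have hfm : Measurable f := by fun_prop
  have hle : ∀ ω, f (X 0 ω) ≤
      (1 + θ * X 0 ω + θ ^ 2 / 3 * X 0 ω ^ 2) * Real.exp (-(θ ^ 2 / 3)) := fun ω => by
    refine mul_le_mul_of_nonneg_right ((exp_sub_sq_div_six_le _).trans_eq ?_) (Real.exp_pos _).le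
    ring
  have hint1 : Integrable (fun ω => 1 + θ * X 0 ω) P :=
    (integrable_const 1).add ((hL2.integrable one_le_two).const_mul θ)
  have hint2 : Integrable (fun ω => θ ^ 2 / 3 * X 0 ω ^ 2) P := hL2.integrable_sq.const_mul _
  have hintB : Integrable (fun ω =>
      (1 + θ * X 0 ω + θ ^ 2 / 3 * X 0 ω ^ 2) * Real.exp (-(θ ^ 2 / 3))) P :=
    (hint1.add hint2).mul_const _
  have hpos : ∀ x, 0 < f x := fun x => mul_pos (Real.exp_pos _) (Real.exp_pos _)
  have hint0 : Integrable (fun ω => f (X 0 ω)) P :=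
    hintB.mono' (hfm.comp (hX 0)).aestronglyMeasurable (Filter.Eventually.of_forall fun ω => by
      rw [Real.norm_of_nonneg (hpos _).le]; exact hle ω)
  have hidf : ∀ i, IdentDistrib (fun ω => f (X i ω)) (fun ω => f (X 0 ω)) P P :=
    fun i => (hid i).comp hfm
  have hq0 : 0 < ∫ ω, f (X 0 ω) ∂P := by
    rw [integral_pos_iff_support_of_nonneg (fun ω => (hpos _).le) hint0]
    have : Function.support (fun ω => f (X 0 ω)) = Set.univ :=
      Set.eq_univ_of_forall fun ω => (hpos _).ne'
    simp [this]
  -- Mean zero and unit variance reduce the claim to 1 + θ²/3 ≤ exp(θ²/3).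
  have hq1 : ∫ ω, f (X 0 ω) ∂P ≤ 1 := by
    refine (integral_mono hint0 hintB hle).trans ?_
    rw [integral_mul_const, integral_add hint1 hint2,
      integral_add (integrable_const 1) ((hL2.integrable one_le_two).const_mul θ),
      integral_const_mul, integral_const_mul, hzero, hone, Real.exp_neg]
    simp only [integral_const, probReal_univ, smul_eq_mul, mul_one, mul_zero, add_zero]
    rw [mul_inv_le_iff₀ (Real.exp_pos _), one_mul, add_comm]
    exact Real.add_one_le_exp _
  have h := iIndepFun.measureReal_exists_prod_ge_le (R := fun i ω => f (X i ω))
    (hind.comp (fun _ => f) fun _ => hfm) (fun i => hfm.comp (hX i))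
    (fun i => (hidf i).symm.integrable_snd hint0) (fun i ω => (hpos _).le) hq0 hq1
    (fun i => (hidf i).integral_eq) (Real.exp_pos b)
  rw [Real.exp_neg, ← one_div]
  refine (measureReal_mono ?_).trans h
  rintro ω ⟨k, hk, hb⟩
  obtain ⟨k, rfl⟩ := Nat.exists_eq_add_of_le' hk
  refine ⟨k, (Real.exp_le_exp.2 hb).trans_eq ?_⟩
  simp only [hf, ← Real.exp_add, ← Real.exp_sum]
  congr 1
  simp only [partialSum, intrinsicTime, Finset.sum_add_distrib, Finset.sum_sub_distrib,
    mul_pow, Finset.sum_const, Finset.card_range, nsmul_eq_mul, ← Finset.mul_sum, ← Finset.sum_div]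
  ring

lemma measureReal_exists_abs_line_crossing_le (hX : ∀ i, Measurable (X i)) (hind : iIndepFun X P)
    (hid : ∀ i, IdentDistrib (X i) (X 0) P P) (hL2 : MemLp (X 0) 2 P) (hzero : ∫ ω, X 0 ω ∂P = 0)
    (hone : ∫ ω, X 0 ω ^ 2 ∂P = 1) (θ b : ℝ) :
    P.real {ω | ∃ k ≥ 1, b ≤ θ * |partialSum X k ω| - θ ^ 2 / 2 * intrinsicTime X k ω} ≤
      2 * Real.exp (-b) := by
  have := hind.isProbabilityMeasure
  have h1 := measureReal_exists_line_crossing_le hX hind hid hL2 hzero hone θ b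
  have h2 := measureReal_exists_line_crossing_le hX hind hid hL2 hzero hone (-θ) b
  rw [two_mul]
  refine (measureReal_mono ?_).trans ((measureReal_union_le _ _).trans (add_le_add h1 h2))
  rintro ω ⟨k, hk, hb⟩
  rcases abs_cases (partialSum X k ω) with ⟨h, _⟩ | ⟨h, _⟩
  · left
    exact ⟨k, hk, by rwa [h] at hb⟩
  · right
    exact ⟨k, hk, by rw [h] at hb; rw [neg_sq]; linarith⟩

end ExponentialBound

/-! ### Stitching lines over geometric epochs. -/

section Stitching

lemma one_le_zeta {z : ℝ} (hz : 1 < z) : 1 ≤ zeta z := by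
  have hs : Summable fun j : ℕ => 1 / ((j : ℝ) + 1) ^ z := by
    simpa using (summable_nat_add_iff 1).2 (Real.summable_one_div_nat_rpow.2 hz)
  simpa [zeta] using hs.le_tsum 0 fun j _ => by positivity

/-- An integral-test comparison in telescoping form, obtained from the tangent bounds for log and
exp. -/
lemma mul_rpow_neg_one_add_le {ε y : ℝ} (hε : 0 < ε) (hy : 0 < y) :
    ε * (y + 1) ^ (-(1 + ε)) ≤ y ^ (-ε) - (y + 1) ^ (-ε) := by
  have hu : 0 < y + 1 := by linarith
  have h1 : y ^ (-ε) = (y + 1) ^ (-ε) * (y / (y + 1)) ^ (-ε) := by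
    rw [← Real.mul_rpow hu.le (by positivity), mul_div_cancel₀ _ hu.ne']
  have h2 : 1 + ε / (y + 1) ≤ (y / (y + 1)) ^ (-ε) := by
    rw [Real.rpow_def_of_pos (by positivity)]
    have hl := Real.log_le_sub_one_of_pos (show 0 < y / (y + 1) by positivity)
    have he := Real.add_one_le_exp (Real.log (y / (y + 1)) * -ε)
    have : y / (y + 1) - 1 = -(1 / (y + 1)) := by field_simp; ring
    rw [this] at hl
    have h3 : ε / (y + 1) = ε * (1 / (y + 1)) := by ring
    rw [h3]
    nlinarith
  have h3 : (y + 1) ^ (-(1 + ε)) = (y + 1) ^ (-ε) / (y + 1) := by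
    rw [neg_add', show -1 - ε = -ε - 1 by ring, Real.rpow_sub_one hu.ne']
  have h4 : 0 < (y + 1) ^ (-ε) := Real.rpow_pos_of_pos hu _
  rw [h1, h3]
  calc ε * ((y + 1) ^ (-ε) / (y + 1)) = (y + 1) ^ (-ε) * (1 + ε / (y + 1)) - (y + 1) ^ (-ε) := by ring
    _ ≤ _ := by gcongr

lemma sum_rpow_neg_one_add_le {ε x : ℝ} (hε : 0 < ε) (hx : 0 < x) (n : ℕ) :
    ∑ j ∈ Finset.range n, (x + j + 1) ^ (-(1 + ε)) ≤ x ^ (-ε) / ε := by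
  rw [le_div_iff₀ hε, mul_comm, Finset.mul_sum]
  calc ∑ j ∈ Finset.range n, ε * (x + j + 1) ^ (-(1 + ε))
      ≤ ∑ j ∈ Finset.range n, ((x + (j : ℕ)) ^ (-ε) - (x + ((j + 1 : ℕ) : ℝ)) ^ (-ε)) :=
        Finset.sum_le_sum fun j _ => by
          have := mul_rpow_neg_one_add_le hε (show 0 < x + j by positivity)
          rwa [Nat.cast_succ, ← add_assoc]
    _ = x ^ (-ε) - (x + n) ^ (-ε) := by
        rw [Finset.sum_range_sub' fun j : ℕ => (x + (j : ℝ)) ^ (-ε)]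
        simp
    _ ≤ x ^ (-ε) := sub_le_self _ (by positivity)

/-- The curve `((η^{1/4} + η^{-1/4}) / √2) √(w η (log log (η w) + ℓ_ε))`, with `η = 1 + ε`, under which
the lines of the individual epochs are stitched together. -/
noncomputable def stitchedBoundary (ε w : ℝ) : ℝ :=
  ((1 + ε) ^ (1 / 4 : ℝ) + (1 + ε) ^ (-(1 / 4) : ℝ)) / Real.sqrt 2 *
    Real.sqrt (w * ((1 + ε) * (Real.log (Real.log ((1 + ε) * w)) + ellConst ε)))

/-- On the epoch `[v, (1 + ε) v)` the line with slope tuned to the geometric midpoint of the epoch lies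
below the curve of height `K`. -/
lemma le_line_of_curve_le {ε v w K s : ℝ} (hε : 0 < ε) (hv : 0 < v) (hvw : v ≤ w)
    (hwv : w ≤ (1 + ε) * v) (hK : 0 ≤ K)
    (hs : ((1 + ε) ^ (1 / 4 : ℝ) + (1 + ε) ^ (-(1 / 4) : ℝ)) / Real.sqrt 2 * Real.sqrt (w * K) ≤ s) :
    K ≤ Real.sqrt (2 * K / (v * Real.sqrt (1 + ε))) * s -
      Real.sqrt (2 * K / (v * Real.sqrt (1 + ε))) ^ 2 / 2 * w := by
  have hη : 0 < 1 + ε := by linarith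
  have hw : 0 < w := hv.trans_le hvw
  set a := (1 + ε) ^ (1 / 4 : ℝ) with ha
  set a' := (1 + ε) ^ (-(1 / 4) : ℝ) with ha'
  have ha0 : 0 < a := Real.rpow_pos_of_pos hη _
  have haa : a * a' = 1 := by rw [ha, ha', ← Real.rpow_add hη]; norm_num
  have hsq : Real.sqrt (1 + ε) = a ^ 2 := by
    rw [Real.sqrt_eq_rpow, ha, ← Real.rpow_natCast, ← Real.rpow_mul hη.le]; norm_num
  have hη4 : 1 + ε = a ^ 4 := by
    rw [ha, ← Real.rpow_natCast, ← Real.rpow_mul hη.le]; norm_num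
  have ha'0 : 0 < a' := Real.rpow_pos_of_pos hη _
  rw [hsq]
  set r := Real.sqrt (w / (v * a ^ 2)) with hr
  have hr2 : r ^ 2 = w / (v * a ^ 2) := Real.sq_sqrt (by positivity)
  have hr0 : 0 ≤ r := Real.sqrt_nonneg _
  have hra : r ≤ a := by
    refine Real.sqrt_le_iff.2 ⟨ha0.le, ?_⟩
    rw [div_le_iff₀ (by positivity)]
    calc w ≤ (1 + ε) * v := hwv
      _ = _ := by rw [hη4]; ring
  have hra' : a' ≤ r := by
    refine Real.le_sqrt_of_sq_le ?_
    rw [le_div_iff₀ (by positivity)]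
    calc a' ^ 2 * (v * a ^ 2) = v * (a * a') ^ 2 := by ring
      _ = v := by rw [haa]; ring
      _ ≤ w := hvw
  -- This is (a - r)(r - a') ≥ 0 with a a' = 1. Multiplied by K it is the conclusion, since θ² w/2 =
  -- K r² and θ s ≥ K r (a + a').
  have hkey : 1 + r ^ 2 ≤ r * (a + a') := by nlinarith [mul_nonneg (sub_nonneg.2 hra) (sub_nonneg.2 hra')]
  have hθ2 : Real.sqrt (2 * K / (v * a ^ 2)) ^ 2 / 2 * w = K * r ^ 2 := by
    rw [Real.sq_sqrt (by positivity), hr2]; ring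
  have hθs : Real.sqrt (2 * K / (v * a ^ 2)) * ((a + a') / Real.sqrt 2 * Real.sqrt (w * K)) =
      K * (r * (a + a')) := by
    have h1 : Real.sqrt (2 * K / (v * a ^ 2)) * Real.sqrt (w * K) = Real.sqrt 2 * (K * r) := by
      rw [← Real.sqrt_mul (by positivity), hr, ← Real.sqrt_sq hK, ← Real.sqrt_mul (sq_nonneg K),
        ← Real.sqrt_mul (by norm_num), Real.sqrt_sq hK]
      congr 1
      ring
    have h2 : Real.sqrt 2 ≠ 0 := by positivity
    calc _ = (a + a') / Real.sqrt 2 * (Real.sqrt (2 * K / (v * a ^ 2)) * Real.sqrt (w * K)) := by ring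
      _ = _ := by rw [h1]; field_simp
  have h3 := mul_le_mul_of_nonneg_left hs (Real.sqrt_nonneg (2 * K / (v * a ^ 2)))
  rw [hθs] at h3
  rw [hθ2]
  nlinarith

variable {Ω : Type*} [MeasurableSpace Ω] {P : Measure Ω} {X : ℕ → Ω → ℝ}

/-- The stitched self-normalized bound for centered i.i.d. variables of unit variance. -/
lemma measureReal_exists_stitchedBoundary_le (hX : ∀ i, Measurable (X i)) (hind : iIndepFun X P)
    (hid : ∀ i, IdentDistrib (X i) (X 0) P P) (hL2 : MemLp (X 0) 2 P) (hzero : ∫ ω, X 0 ω ∂P = 0)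
    (hone : ∫ ω, X 0 ω ^ 2 ∂P = 1) {ε : ℝ} (hε : 0 < ε) {m : ℕ} (hm : 2 ≤ m) :
    P.real {ω | ∃ k ≥ m, stitchedBoundary ε (intrinsicTime X k ω) ≤ |partialSum X k ω|} ≤
      Real.logb (1 + ε) (2 * m / 3) ^ (-ε) / (ε * zeta (1 + ε)) := by
  have := hind.isProbabilityMeasure
  have hη : 1 < 1 + ε := by linarith
  have hη0 : 0 < 1 + ε := by linarith
  have hm' : (2 : ℝ) ≤ m := by exact_mod_cast hm
  have hv0 : 1 < 2 * (m : ℝ) / 3 := by linarith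
  have hζ := one_le_zeta hη
  have hlogη : 0 < Real.log (1 + ε) := Real.log_pos hη
  set x := Real.logb (1 + ε) (2 * m / 3) with hx
  have hx0 : 0 < x := Real.logb_pos hη hv0
  set v : ℕ → ℝ := fun j => (1 + ε) ^ j * (2 * m / 3) with hv
  have hvpos : ∀ j, 0 < v j := fun j => by positivity
  -- Chosen so that the two-sided error 2 exp(-K j) equals (x+j+1)^(-(1+ε))/ζ(1+ε); here x+j+1 is
  -- the logarithm of (1+ε) v_j to base 1+ε.
  set K : ℕ → ℝ := fun j => Real.log (2 * zeta (1 + ε) * (x + j + 1) ^ (1 + ε)) with hK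
  have hone_le : ∀ j : ℕ, 1 ≤ (x + j + 1) ^ (1 + ε) := fun j =>
    Real.one_le_rpow (by have : (0 : ℝ) ≤ j := j.cast_nonneg; linarith) hη0.le
  have hKpos : ∀ j, 0 ≤ K j := fun j => Real.log_nonneg (by nlinarith [hone_le j])
  set θ : ℕ → ℝ := fun j => Real.sqrt (2 * K j / (v j * Real.sqrt (1 + ε))) with hθ
  refine (measureReal_mono (s₂ := {ω | ∃ j : ℕ, ∃ k ≥ 1,
    K j ≤ θ j * |partialSum X k ω| - θ j ^ 2 / 2 * intrinsicTime X k ω}) ?_).trans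
    (measureReal_exists_le_of_sum_le (b := fun j => 1 / zeta (1 + ε) * (x + j + 1) ^ (-(1 + ε)))
      (fun j => ?_) fun n => ?_)
  · rintro ω ⟨k, hk, hS⟩
    set w := intrinsicTime X k ω
    have hw : 2 * (m : ℝ) / 3 ≤ w := by
      refine le_trans ?_ (two_thirds_mul_le_intrinsicTime k ω)
      have : (m : ℝ) ≤ k := by exact_mod_cast hk
      linarith
    obtain ⟨j, hj1, hj2⟩ := exists_nat_pow_near ((one_le_div (by linarith)).2 hw) hη
    rw [le_div_iff₀ (by linarith)] at hj1
    rw [div_lt_iff₀ (by linarith), pow_succ'] at hj2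
    have hw0 : 0 < w := by linarith
    refine ⟨j, k, by omega, le_line_of_curve_le hε (hvpos j) hj1 (by rw [hv, ← mul_assoc]; exact hj2.le)
      (hKpos j) (le_trans ?_ hS)⟩
    rw [stitchedBoundary]
    gcongr
    have hlog : x + j + 1 ≤ Real.log ((1 + ε) * w) / Real.log (1 + ε) := by
      rw [le_div_iff₀ hlogη]
      have h1 : (x + j + 1) * Real.log (1 + ε) = Real.log ((1 + ε) * v j) := by
        rw [hv, Real.log_mul hη0.ne' (hvpos j).ne', Real.log_mul (by positivity) (by positivity),
          Real.log_pow, hx, Real.logb]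
        field_simp
        ring
      rw [h1]
      exact Real.log_le_log (mul_pos hη0 (hvpos j)) (by gcongr)
    have hxj : 0 < x + j + 1 := by positivity
    have hL : 0 < Real.log ((1 + ε) * w) := Real.log_pos (by nlinarith)
    calc K j = Real.log (2 * zeta (1 + ε)) + (1 + ε) * Real.log (x + j + 1) := by
          rw [hK]
          simp only
          rw [Real.log_mul (by positivity) (by positivity), Real.log_rpow hxj]
      _ ≤ (1 + ε) * Real.log (2 * zeta (1 + ε)) +
          (1 + ε) * Real.log (Real.log ((1 + ε) * w) / Real.log (1 + ε)) := by
          have h1 : 0 ≤ Real.log (2 * zeta (1 + ε)) := Real.log_nonneg (by linarith)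
          have h2 := Real.log_le_log hxj hlog
          gcongr
          nlinarith
      _ = _ := by
          rw [ellConst, Real.log_div hL.ne' hlogη.ne', Real.log_div (by positivity) hlogη.ne']
          ring
  · refine (measureReal_exists_abs_line_crossing_le hX hind hid hL2 hzero hone (θ j) (K j)).trans
      (le_of_eq ?_)
    have hxj : 0 < x + j + 1 := by positivity
    simp only [hK]
    rw [Real.exp_neg, Real.exp_log (by positivity), Real.rpow_neg hxj.le]
    field_simp
  · rw [← Finset.mul_sum]
    calc _ ≤ 1 / zeta (1 + ε) * (x ^ (-ε) / ε) := by
          gcongr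
          exact sum_rpow_neg_one_add_le hε hx0 n
      _ = _ := by field_simp

end Stitching

/-! ### From intrinsic time to the sample variance. -/

section SampleVariance

lemma mul_sampleVariance {Ω : Type*} {X : ℕ → Ω → ℝ} {k : ℕ} (hk : 0 < k) (ω : Ω) :
    k * sampleVariance X k ω =
      (∑ i ∈ Finset.range k, X i ω ^ 2) - partialSum X k ω ^ 2 / k := by
  have hk' : (k : ℝ) ≠ 0 := by exact_mod_cast hk.ne'
  rw [sampleVariance, ← mul_assoc, mul_one_div_cancel hk', one_mul]
  simp only [sub_sq, Finset.sum_add_distrib, Finset.sum_sub_distrib, ← Finset.sum_mul,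
    ← Finset.mul_sum, Finset.sum_const, Finset.card_range, nsmul_eq_mul, sampleMean, partialSum]
  field_simp
  ring

lemma sampleVariance_nonneg {Ω : Type*} {X : ℕ → Ω → ℝ} (k : ℕ) (ω : Ω) :
    0 ≤ sampleVariance X k ω :=
  mul_nonneg (by positivity) (Finset.sum_nonneg fun _ _ => sq_nonneg _)

/-- The constant is 1+ε times the prefactor of `stitchedBoundary`. One √(1+ε) absorbs the factor in
front of the iterated logarithm there; the other is the spare one. -/
lemma cConst_eq {ε : ℝ} (hε : 0 < ε) :
    cConst ε = (1 + ε) *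
      (((1 + ε) ^ (1 / 4 : ℝ) + (1 + ε) ^ (-(1 / 4) : ℝ)) / Real.sqrt 2) := by
  have hη : 0 < 1 + ε := by linarith
  rw [cConst, ← mul_div_assoc, mul_add, ← Real.rpow_one_add' hη.le (by norm_num),
    ← Real.rpow_one_add' hη.le (by norm_num)]
  norm_num

lemma log_log_add_ellConst_nonneg {ε w : ℝ} (hε : 0 < ε) (hw : 1 ≤ w) :
    0 ≤ Real.log (Real.log ((1 + ε) * w)) + ellConst ε := by
  have hlog : 0 < Real.log (1 + ε) := Real.log_pos (by linarith)
  have hζ := one_le_zeta (show 1 < 1 + ε by linarith)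
  have h1 : Real.log (1 + ε) ≤ Real.log ((1 + ε) * w) :=
    Real.log_le_log (by linarith) (by nlinarith)
  have h2 := Real.log_le_log hlog h1
  have h3 : 0 ≤ Real.log (2 * zeta (1 + ε)) := Real.log_nonneg (by linarith)
  rw [ellConst, Real.log_div (by positivity) hlog.ne']
  linarith

/-- If the empirical first and second moments are close to `0` and `1`, then the stitched curve at the
intrinsic time lies below the studentized boundary, shrunk by `1 / √(1 + ε)`. -/
lemma stitchedBoundary_le_boundary_mul_sampleStd {Ω : Type*} {X : ℕ → Ω → ℝ} {k : ℕ} (hk : 2 ≤ k)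
    {ω : Ω} {ε e : ℝ} (he : 0 < e) (he1 : e ≤ 1) (heε : e ≤ ε)
    (hlow : (1 - e / 2) * k ≤ ∑ i ∈ Finset.range k, X i ω ^ 2)
    (hup : ∑ i ∈ Finset.range k, X i ω ^ 2 ≤ (1 + 3 * e) * k)
    (hmean : partialSum X k ω ^ 2 ≤ e / 8 * k ^ 2) :
    stitchedBoundary ε (intrinsicTime X k ω) ≤
      1 / Real.sqrt (1 + ε) * boundary ε k * sampleStd X k ω := by
  have hε : 0 < ε := he.trans_le heε
  have hη : 0 < 1 + ε := by linarith
  have hk' : (2 : ℝ) ≤ k := by exact_mod_cast hk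
  have hk0 : (0 : ℝ) < k := by linarith
  have hvar := mul_sampleVariance (X := X) (show 0 < k by omega) ω
  have hw := two_thirds_mul_le_intrinsicTime (X := X) k ω
  have hw1 : 1 < intrinsicTime X k ω := by linarith
  have hwk : intrinsicTime X k ω ≤ (1 + ε) * k := by
    rw [intrinsicTime]
    nlinarith
  have hwv : intrinsicTime X k ω ≤ (1 + 2 * ε) * (k * sampleVariance X k ω) := by
    have hS : partialSum X k ω ^ 2 / k ≤ e / 8 * k := by
      rw [div_le_iff₀ hk0]
      linarith
    have h1 : (1 + 2 * e) * (k * sampleVariance X k ω) ≤ (1 + 2 * ε) * (k * sampleVariance X k ω) := by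
      have := sampleVariance_nonneg (X := X) k ω
      gcongr
    refine le_trans ?_ h1
    rw [hvar, intrinsicTime]
    set V := ∑ i ∈ Finset.range k, X i ω ^ 2
    have h2 := mul_le_mul_of_nonneg_left hlow (show 0 ≤ 2 / 3 + 2 * e by positivity)
    have h3 := mul_le_mul_of_nonneg_left hS (show 0 ≤ 1 + 2 * e by positivity)
    have h4 : 0 ≤ e * (1 - e) * k := by
      have := sub_nonneg.2 he1
      positivity
    have h5 : 0 ≤ e * k := by positivity
    nlinarith
  set w := intrinsicTime X k ω
  have hLk : Real.log (Real.log ((1 + ε) * w)) + ellConst ε ≤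
      Real.log (Real.log ((1 + ε) ^ 2 * k)) + ellConst ε := by
    have h1 : 0 < Real.log ((1 + ε) * w) := Real.log_pos (by nlinarith)
    have h2 : (1 + ε) * w ≤ (1 + ε) ^ 2 * k := by
      rw [sq, mul_assoc]
      gcongr
    have h3 := Real.log_le_log (by positivity) h2
    gcongr
  have hL0 := log_log_add_ellConst_nonneg hε hw1.le
  set Lw := Real.log (Real.log ((1 + ε) * w)) + ellConst ε
  rw [stitchedBoundary, boundary, cConst_eq hε, sampleStd]
  set A := ((1 + ε) ^ (1 / 4 : ℝ) + (1 + ε) ^ (-(1 / 4) : ℝ)) / Real.sqrt 2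
  set L := Real.log (Real.log ((1 + ε) ^ 2 * k)) + ellConst ε
  have hA : 0 ≤ A := by positivity
  have hsη : 1 / Real.sqrt (1 + ε) * (1 + ε) = Real.sqrt (1 + ε) := by
    rw [one_div, inv_mul_eq_div, Real.div_sqrt]
  calc A * Real.sqrt (w * ((1 + ε) * Lw))
      ≤ A * Real.sqrt ((1 + ε) * ((1 + 2 * ε) * k * L * sampleVariance X k ω)) := by
        gcongr A * Real.sqrt ?_
        have h1 : w * Lw ≤ (1 + 2 * ε) * (k * sampleVariance X k ω) * L :=
          mul_le_mul hwv hLk hL0 (by linarith)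
        calc w * ((1 + ε) * Lw) = (1 + ε) * (w * Lw) := by ring
          _ ≤ (1 + ε) * ((1 + 2 * ε) * (k * sampleVariance X k ω) * L) := by gcongr
          _ = _ := by ring
    _ = A * (Real.sqrt (1 + ε) * (Real.sqrt ((1 + 2 * ε) * k * L) *
          Real.sqrt (sampleVariance X k ω))) := by
        rw [Real.sqrt_mul hη.le, Real.sqrt_mul' _ (sampleVariance_nonneg k ω)]
    _ = A * (1 / Real.sqrt (1 + ε) * (1 + ε) * (Real.sqrt ((1 + 2 * ε) * k * L) *
          Real.sqrt (sampleVariance X k ω))) := by rw [hsη]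
    _ = _ := by ring

end SampleVariance

/-! ### Uniform control of the empirical moments by truncation. -/

section Truncation

/-- The square of `x`, truncated to `0` unless it lies below `a`. -/
noncomputable def sqBelow (a x : ℝ) : ℝ := Set.indicator {y | y ^ 2 < a} (fun y => y ^ 2) x

/-- The square of `x`, truncated to `0` if it lies below `a`. -/
noncomputable def sqAbove (a x : ℝ) : ℝ := Set.indicator {y | a ≤ y ^ 2} (fun y => y ^ 2) x

lemma sqBelow_add_sqAbove (a x : ℝ) : sqBelow a x + sqAbove a x = x ^ 2 := by
  simp only [sqBelow, sqAbove, Set.indicator_apply, Set.mem_ofPred_eq]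
  split_ifs <;> linarith

lemma sqBelow_nonneg (a x : ℝ) : 0 ≤ sqBelow a x :=
  Set.indicator_nonneg (fun _ _ => sq_nonneg _) _

lemma sqAbove_nonneg (a x : ℝ) : 0 ≤ sqAbove a x :=
  Set.indicator_nonneg (fun _ _ => sq_nonneg _) _

lemma sqBelow_sq_le {a : ℝ} (ha : 0 ≤ a) (x : ℝ) : sqBelow a x ^ 2 ≤ a * x ^ 2 := by
  simp only [sqBelow, Set.indicator_apply, Set.mem_ofPred_eq]
  split_ifs with h
  · nlinarith [sq_nonneg x]
  · have := sq_nonneg x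
    simp only [ne_eq, OfNat.ofNat_ne_zero, not_false_eq_true, zero_pow]
    positivity

lemma measurable_sqBelow (a : ℝ) : Measurable (sqBelow a) :=
  (measurable_id.pow_const 2).indicator (measurableSet_lt (measurable_id.pow_const 2) measurable_const)

lemma measurable_sqAbove (a : ℝ) : Measurable (sqAbove a) :=
  (measurable_id.pow_const 2).indicator (measurableSet_le measurable_const (measurable_id.pow_const 2))

variable {Ω : Type*} [MeasurableSpace Ω] {P : Measure Ω} {X : ℕ → Ω → ℝ}

/-- The averages of the truncated squares stay close to their mean. -/
lemma measureReal_exists_sum_sqBelow_le (hX : ∀ i, Measurable (X i)) (hind : iIndepFun X P)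
    (hid : ∀ i, IdentDistrib (X i) (X 0) P P) (hL2 : MemLp (X 0) 2 P)
    (hone : ∫ ω, X 0 ω ^ 2 ∂P = 1) {a : ℝ} (ha : 0 ≤ a) {δ : ℝ} (hδ : 0 < δ) {m : ℕ} (hm : 0 < m) :
    P.real {ω | ∃ k ≥ m, δ * k ≤ |∑ i ∈ Finset.range k,
      (sqBelow a (X i ω) - ∫ ω, sqBelow a (X 0 ω) ∂P)|} ≤ 4 * a / (δ ^ 2 * m) := by
  have := hind.isProbabilityMeasure
  set c := ∫ ω, sqBelow a (X 0 ω) ∂P with hc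
  have hgm : Measurable fun x => sqBelow a x - c := (measurable_sqBelow a).sub_const c
  have hBm : Measurable fun ω => sqBelow a (X 0 ω) := (measurable_sqBelow a).comp (hX 0)
  have hB0 : MemLp (fun ω => sqBelow a (X 0 ω)) 2 P := by
    rw [memLp_two_iff_integrable_sq hBm.aestronglyMeasurable]
    refine (hL2.integrable_sq.const_mul a).mono'
      (hBm.pow_const 2).aestronglyMeasurable
      (Filter.Eventually.of_forall fun ω => ?_)
    rw [Real.norm_of_nonneg (sq_nonneg _)]
    exact sqBelow_sq_le ha _
  have hidg : ∀ i, IdentDistrib (fun ω => sqBelow a (X i ω) - c)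
      (fun ω => sqBelow a (X 0 ω) - c) P P := fun i => (hid i).comp hgm
  have h0 : MemLp (fun ω => sqBelow a (X 0 ω) - c) 2 P := hB0.sub (memLp_const c)
  have hvar : ∫ ω, (sqBelow a (X 0 ω) - c) ^ 2 ∂P ≤ a := by
    rw [hc, ← variance_eq_integral hBm.aemeasurable]
    refine (variance_le_expectation_sq
      hBm.aestronglyMeasurable).trans ?_
    calc ∫ ω, sqBelow a (X 0 ω) ^ 2 ∂P ≤ ∫ ω, a * X 0 ω ^ 2 ∂P :=
          integral_mono hB0.integrable_sq (hL2.integrable_sq.const_mul a) fun ω => sqBelow_sq_le ha _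
      _ = a := by rw [integral_const_mul, hone, mul_one]
  refine iIndepFun.measureReal_exists_ge_abs_sum_ge_le (Y := fun i ω => sqBelow a (X i ω) - c)
    (hind.comp (fun _ x => sqBelow a x - c) fun _ => hgm) (fun i => hgm.comp (hX i))
    (fun i => (hidg i).symm.memLp_snd h0) (fun i => ?_) (fun i => ?_) hδ hm
  · rw [(hidg i).integral_eq, integral_sub (hB0.integrable one_le_two) (integrable_const c)]
    simp [hc]
  · exact ((hidg i).comp (measurable_id.pow_const 2)).integral_eq.trans_le hvar

/-- With high probability all empirical second moments of order at least `m` are close to `1`, and all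
empirical means are close to `0`. -/
lemma measureReal_exists_moments_far_le (hX : ∀ i, Measurable (X i)) (hind : iIndepFun X P)
    (hid : ∀ i, IdentDistrib (X i) (X 0) P P) (hL2 : MemLp (X 0) 2 P) (hzero : ∫ ω, X 0 ω ∂P = 0)
    (hone : ∫ ω, X 0 ω ^ 2 ∂P = 1) {a : ℝ} (ha : 0 ≤ a) {e : ℝ} (he : 0 < e)
    (hU : ∫ ω, sqAbove a (X 0 ω) ∂P ≤ e / 4) {m : ℕ} (hm : 0 < m) :
    P.real {ω | ∃ k ≥ m, ¬ ((1 - e / 2) * k ≤ ∑ i ∈ Finset.range k, X i ω ^ 2 ∧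
      ∑ i ∈ Finset.range k, X i ω ^ 2 ≤ (1 + 3 * e) * k ∧
      partialSum X k ω ^ 2 ≤ e / 8 * (k : ℝ) ^ 2)} ≤
      32 / (e * m) + 64 * a / (e ^ 2 * m) + (∫ ω, sqAbove a (X 0 ω) ∂P) / e := by
  have := hind.isProbabilityMeasure
  have hm' : (0 : ℝ) < m := by exact_mod_cast hm
  have hA : Integrable (fun ω => sqAbove a (X 0 ω)) P := by
    refine hL2.integrable_sq.mono' ((measurable_sqAbove a).comp (hX 0)).aestronglyMeasurable
      (Filter.Eventually.of_forall fun ω => ?_)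
    rw [Real.norm_of_nonneg (sqAbove_nonneg _ _)]
    linarith [sqBelow_add_sqAbove a (X 0 ω), sqBelow_nonneg a (X 0 ω)]
  have hc : ∫ ω, sqBelow a (X 0 ω) ∂P = 1 - ∫ ω, sqAbove a (X 0 ω) ∂P := by
    rw [← hone, ← integral_sub hL2.integrable_sq hA]
    refine integral_congr_ae (Filter.Eventually.of_forall fun ω => ?_)
    simp only [← sqBelow_add_sqAbove a (X 0 ω)]
    ring
  have hU0 : 0 ≤ ∫ ω, sqAbove a (X 0 ω) ∂P := integral_nonneg fun ω => sqAbove_nonneg _ _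
  -- Three failure events: a large empirical mean, small squares off their mean by e/4 on average,
  -- and large squares averaging above e. The truncated mean is itself within e/4 of 1.
  have h1 := iIndepFun.measureReal_exists_ge_abs_sum_ge_le (δ := Real.sqrt (e / 8)) (s := 1) hind hX
    (fun i => (hid i).symm.memLp_snd hL2) (fun i => (hid i).integral_eq.trans hzero)
    (fun i => ((hid i).sq.integral_eq.trans hone).le) (by positivity) hm
  have h2 := measureReal_exists_sum_sqBelow_le hX hind hid hL2 hone ha
    (show 0 < e / 4 by positivity) hm
  have h3 := measureReal_exists_sum_gt_le (Z := fun i ω => sqAbove a (X i ω))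
    (fun i => (measurable_sqAbove a).comp (hX i)) (hind.comp (fun _ => sqAbove a) fun _ =>
      measurable_sqAbove a) (fun i => (hid i).comp (measurable_sqAbove a)) hA
      (fun ω => sqAbove_nonneg _ _) he
  rw [Real.sq_sqrt (by positivity)] at h1
  have e1 : 4 * 1 / (e / 8 * m) = 32 / (e * m) := by field_simp; norm_num
  have e2 : 4 * a / ((e / 4) ^ 2 * m) = 64 * a / (e ^ 2 * m) := by field_simp; ring
  rw [e1] at h1
  rw [e2] at h2
  refine (measureReal_mono ?_).trans ((measureReal_union_le _ _).trans
    (add_le_add ((measureReal_union_le _ _).trans (add_le_add h1 h2)) h3))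
  rintro ω ⟨k, hk, hbad⟩
  by_contra hcon
  simp only [Set.mem_union, Set.mem_ofPred_eq, not_or, not_exists, not_and, not_le, not_lt] at hcon
  obtain ⟨⟨c1, c2⟩, c3⟩ := hcon
  have c1 := c1 k hk
  have c2 := c2 k hk
  have c3 := c3 k
  have hk0 : (0 : ℝ) < k := hm'.trans_le (by exact_mod_cast hk)
  rw [Finset.sum_sub_distrib, Finset.sum_const, Finset.card_range, nsmul_eq_mul, hc, abs_lt] at c2
  have hV : ∑ i ∈ Finset.range k, X i ω ^ 2 =
      ∑ i ∈ Finset.range k, sqBelow a (X i ω) + ∑ i ∈ Finset.range k, sqAbove a (X i ω) := by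
    rw [← Finset.sum_add_distrib]
    exact Finset.sum_congr rfl fun i _ => (sqBelow_add_sqAbove _ _).symm
  have hA0 : 0 ≤ ∑ i ∈ Finset.range k, sqAbove a (X i ω) :=
    Finset.sum_nonneg fun i _ => sqAbove_nonneg _ _
  refine hbad ⟨?_, ?_, ?_⟩
  · rw [hV]
    nlinarith
  · rw [hV]
    nlinarith [mul_pos he hk0, mul_nonneg hU0 hk0.le]
  · calc partialSum X k ω ^ 2 = |∑ i ∈ Finset.range k, X i ω| ^ 2 := by rw [sq_abs, partialSum]
      _ ≤ (Real.sqrt (e / 8) * k) ^ 2 := by gcongr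
      _ = _ := by rw [mul_pow, Real.sq_sqrt (by positivity)]

end Truncation

/-! ### Scaling, and the bound for unit variance. -/

section Normalization

variable {Ω : Type*}

lemma partialSum_div (X : ℕ → Ω → ℝ) (σ : ℝ) (k : ℕ) (ω : Ω) :
    partialSum (fun i ω => X i ω / σ) k ω = partialSum X k ω / σ := by
  simp only [partialSum, Finset.sum_div]

lemma sampleStd_div (X : ℕ → Ω → ℝ) {σ : ℝ} (hσ : 0 < σ) (k : ℕ) (ω : Ω) :
    sampleStd (fun i ω => X i ω / σ) k ω = sampleStd X k ω / σ := by
  have h : sampleVariance (fun i ω => X i ω / σ) k ω = sampleVariance X k ω / σ ^ 2 := by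
    simp only [sampleVariance, sampleMean, ← Finset.sum_div, ← mul_div_assoc, ← sub_div, div_pow]
  rw [sampleStd, h, Real.sqrt_div' _ (sq_nonneg σ), Real.sqrt_sq hσ.le, sampleStd]

/-- If every ratio were at most r < 1, so would be the supremum. Clearing denominators in this
direction stays valid when they vanish. -/
lemma exists_mul_lt_abs_partialSum {X : ℕ → Ω → ℝ} {ε : ℝ} {m : ℕ} {ω : Ω} {r : ℝ} (hr0 : 0 ≤ r)
    (hr : r < 1) (h : 1 ≤ ⨆ k ≥ m, studentizedRatio X ε k ω) :
    ∃ k ≥ m, r * boundary ε k * sampleStd X k ω < |partialSum X k ω| := by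
  by_contra! hcon
  refine absurd h (not_le.2 (lt_of_le_of_lt (iSup₂_le fun k hk => ?_) (ENNReal.ofReal_lt_one.2 hr)))
  refine ENNReal.div_le_of_le_mul (ENNReal.div_le_of_le_mul ?_)
  have hs : 0 ≤ sampleStd X k ω := Real.sqrt_nonneg _
  rw [← ENNReal.ofReal_mul hr0, ← ENNReal.ofReal_mul' hs]
  exact ENNReal.ofReal_le_ofReal (hcon k hk)

variable [MeasurableSpace Ω] {P : Measure Ω} {X : ℕ → Ω → ℝ}

lemma logb_rpow_div_nonneg {ε : ℝ} (hε : 0 < ε) {m : ℕ} (hm : 2 ≤ m) :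
    0 ≤ Real.logb (1 + ε) (2 * m / 3) ^ (-ε) / (ε * zeta (1 + ε)) := by
  have hm' : (2 : ℝ) ≤ m := by exact_mod_cast hm
  have hζ := one_le_zeta (show 1 < 1 + ε by linarith)
  have := Real.logb_pos (show 1 < 1 + ε by linarith) (show 1 < 2 * (m : ℝ) / 3 by linarith)
  positivity

/-- The bound for variables of unit variance. -/
lemma measureReal_exists_boundary_lt_le (hX : ∀ i, Measurable (X i)) (hind : iIndepFun X P)
    (hid : ∀ i, IdentDistrib (X i) (X 0) P P) (hL2 : MemLp (X 0) 2 P) (hzero : ∫ ω, X 0 ω ∂P = 0)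
    (hone : ∫ ω, X 0 ω ^ 2 ∂P = 1) {ε : ℝ} (hε : 0 < ε) {lam : ℝ} (hlam : 0 < lam) {m : ℕ}
    (hm : 2 ≤ m) :
    P.real {ω | ∃ k ≥ m, 1 / Real.sqrt (1 + ε) * boundary ε k * sampleStd X k ω <
        |partialSum X k ω|} ≤
      Real.logb (1 + ε) (2 * m / 3) ^ (-ε) / (ε * zeta (1 + ε)) +
        786 / min (ε ^ 2) 1 * ((m : ℝ) ^ (2 * lam - 1) +
          ∫ ω, sqAbove ((m : ℝ) ^ lam) (X 0 ω) ∂P) := by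
  have := hind.isProbabilityMeasure
  have hm' : (2 : ℝ) ≤ m := by exact_mod_cast hm
  have hm0 : (0 : ℝ) < m := by linarith
  set U := ∫ ω, sqAbove ((m : ℝ) ^ lam) (X 0 ω) ∂P with hUdef
  have hU0 : 0 ≤ U := integral_nonneg fun ω => sqAbove_nonneg _ _
  set T := (m : ℝ) ^ (2 * lam - 1) with hT
  have hT0 : 0 < T := Real.rpow_pos_of_pos hm0 _
  obtain ⟨e, he, he1, heε, hemin⟩ : ∃ e : ℝ, 0 < e ∧ e ≤ 1 ∧ e ≤ ε ∧ min (ε ^ 2) 1 = e ^ 2 := by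
    rcases le_total ε 1 with h | h
    · exact ⟨ε, hε, h, le_rfl, min_eq_left (by nlinarith)⟩
    · exact ⟨1, one_pos, le_rfl, h, by rw [one_pow]; exact min_eq_right (by nlinarith)⟩
  rw [hemin]
  have hfirst := logb_rpow_div_nonneg hε hm
  -- If the second term is at least 1 there is nothing to prove; otherwise U < e²/786 ≤ e/4, as the
  -- moment estimate requires.
  by_cases htriv : 1 ≤ 786 / e ^ 2 * (T + U)
  · exact measureReal_le_one.trans (by linarith)
  have hU : U ≤ e / 4 := by
    rw [not_le, div_mul_eq_mul_div, div_lt_one (by positivity)] at htriv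
    nlinarith
  have h1 := measureReal_exists_stitchedBoundary_le hX hind hid hL2 hzero hone hε hm
  have h2 := measureReal_exists_moments_far_le hX hind hid hL2 hzero hone
    (Real.rpow_nonneg hm0.le lam) he hU (show 0 < m by omega)
  have hbad : 32 / (e * m) + 64 * (m : ℝ) ^ lam / (e ^ 2 * m) + U / e ≤ 786 / e ^ 2 * (T + U) := by
    have hee : e ^ 2 ≤ e := by nlinarith
    have hT1 : 1 / (m : ℝ) ≤ T := by
      rw [one_div, ← Real.rpow_neg_one]
      exact Real.rpow_le_rpow_of_exponent_le (by linarith) (by linarith)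
    have hT2 : (m : ℝ) ^ lam / m ≤ T := by
      rw [← Real.rpow_sub_one hm0.ne']
      exact Real.rpow_le_rpow_of_exponent_le (by linarith) (by linarith)
    calc 32 / (e * m) + 64 * (m : ℝ) ^ lam / (e ^ 2 * m) + U / e
        = 32 / e * (1 / m) + 64 / e ^ 2 * ((m : ℝ) ^ lam / m) + U / e := by
          field_simp
      _ ≤ 32 / e ^ 2 * T + 64 / e ^ 2 * T + U / e ^ 2 := by gcongr
      _ = (96 * T + U) / e ^ 2 := by ring
      _ ≤ (786 * (T + U)) / e ^ 2 := by gcongr; linarith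
      _ = _ := by ring
  refine (measureReal_mono ?_).trans ((measureReal_union_le _ _).trans
    (add_le_add h1 (h2.trans hbad)))
  rintro ω ⟨k, hk, hlt⟩
  by_cases hgood : (1 - e / 2) * k ≤ ∑ i ∈ Finset.range k, X i ω ^ 2 ∧
      ∑ i ∈ Finset.range k, X i ω ^ 2 ≤ (1 + 3 * e) * k ∧
      partialSum X k ω ^ 2 ≤ e / 8 * (k : ℝ) ^ 2
  · exact Or.inl ⟨k, hk, (stitchedBoundary_le_boundary_mul_sampleStd (hm.trans hk) he he1 heε
      hgood.1 hgood.2.1 hgood.2.2).trans hlt.le⟩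
  · exact Or.inr ⟨k, hk, hgood⟩

end Normalization

end StudentizedLIL

/-! ### The theorem for general variance. -/

open StudentizedLIL

theorem mainTheorem4 {Ω : Type*} [MeasurableSpace Ω] (X : ℕ → Ω → ℝ)
    (hX : ∀ i, Measurable (X i)) (P : Measure Ω) (hP : StudentizedLIL.IsCenteredIID X P)
    (hvar : MemLp (X 0) 2 P) (ε : ℝ) (hε : 0 < ε) (lam : ℝ) (hlam : lam ∈ Set.Ioo (0 : ℝ) (1 / 2))
    (m : ℕ) (hm : 2 ≤ m) :
    P.real {ω | 1 ≤ ⨆ k ≥ m, StudentizedLIL.studentizedRatio X ε k ω} ≤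
      (Real.logb (1 + ε) (2 * m / 3)) ^ (-ε) / (ε * StudentizedLIL.zeta (1 + ε)) +
        786 / min (ε ^ 2) 1 * ((m : ℝ) ^ (2 * lam - 1) +
          StudentizedLIL.truncatedNormalizedSecondMoment X P ((m : ℝ) ^ lam)) := by
  have := hP.isProbabilityMeasure
  have hV : variance (X 0) P = ∫ ω, X 0 ω ^ 2 ∂P :=
    variance_of_integral_eq_zero (hX 0).aemeasurable hP.mean_zero
  have hsup := fun ω => exists_mul_lt_abs_partialSum (X := X) (ε := ε) (m := m) (ω := ω)
    (r := 1 / Real.sqrt (1 + ε)) (by positivity) (by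
      rw [div_lt_one (by positivity), Real.lt_sqrt zero_le_one]; linarith)
  -- With zero variance almost surely every X_i vanishes, and the strict crossing would read 0 < 0.
  -- Otherwise both sides of the crossing scale by σ.
  rcases (variance_nonneg (X 0) P).eq_or_lt' with hv | hv
  · have h0 : ∀ᵐ ω ∂P, ∀ i, X i ω = 0 := by
      refine ae_all_iff.2 fun i => ?_
      have h : ∀ᵐ ω ∂P, X 0 ω = 0 := by
        filter_upwards [ae_eq_integral_of_variance_eq_zero hvar hv] with ω hω
        rw [hω, hP.mean_zero]
      exact (hP.identDistrib i).symm.ae_snd (p := fun x => x = 0) (measurableSet_singleton 0) h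
    have hnull : P {ω | 1 ≤ ⨆ k ≥ m, studentizedRatio X ε k ω} = 0 := by
      refine measure_mono_null ?_ (ae_iff.1 h0)
      rintro ω hω h
      obtain ⟨k, -, hlt⟩ := hsup ω hω
      simp [partialSum, sampleStd, sampleVariance, sampleMean, h] at hlt
    have hU : 0 ≤ truncatedNormalizedSecondMoment X P ((m : ℝ) ^ lam) :=
      integral_nonneg fun ω => Set.indicator_nonneg
        (fun ω _ => div_nonneg (sq_nonneg _) (variance_nonneg _ _)) _
    have hfirst := logb_rpow_div_nonneg hε hm
    rw [Measure.real, hnull, ENNReal.toReal_zero]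
    have hmin : 0 < min (ε ^ 2) 1 := lt_min (by positivity) one_pos
    positivity
  · set σ := Real.sqrt (variance (X 0) P) with hσ
    have hσ0 : 0 < σ := Real.sqrt_pos.2 hv
    have hσ2 : σ ^ 2 = variance (X 0) P := Real.sq_sqrt hv.le
    have hdiv : Measurable fun x : ℝ => x / σ := measurable_id.div_const σ
    have hmain := measureReal_exists_boundary_lt_le (X := fun i ω => X i ω / σ) (P := P)
      (fun i => hdiv.comp (hX i)) (hP.indep.comp (fun _ x => x / σ) fun _ => hdiv)
      (fun i => (hP.identDistrib i).div_const σ)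
      (by simpa only [div_eq_mul_inv] using hvar.mul_const σ⁻¹)
      (by rw [integral_div, hP.mean_zero, zero_div])
      (by simp only [div_pow]; rw [integral_div, ← hV, hσ2, div_self hv.ne']) hε hlam.1 hm
    have hU : ∫ ω, sqAbove ((m : ℝ) ^ lam) (X 0 ω / σ) ∂P =
        truncatedNormalizedSecondMoment X P ((m : ℝ) ^ lam) := by
      simp only [truncatedNormalizedSecondMoment, sqAbove, Set.indicator_apply, Set.mem_ofPred_eq,
        div_pow, hσ2]
    rw [hU] at hmain
    refine (measureReal_mono fun ω hω => ?_).trans hmain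
    obtain ⟨k, hk, hlt⟩ := hsup ω hω
    refine ⟨k, hk, ?_⟩
    rw [partialSum_div, sampleStd_div X hσ0, abs_div, abs_of_pos hσ0, ← mul_div_assoc]
    gcongr
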